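/- Let $n\ge 2$, let $t_0<T$ be real numbers, and let $a_0,a_1,\dots,a_n$ be real-valued continuous functions on $[t_0,T]$. Consider the equation $$y'+\sum_{k=0}^{n}a_k(t)\,y^k=0,\qquad t\in[t_0,T].\tag{1.1}$$ A solution $y$ of (1.1) on $[t_0,T]$ is called closed if $y(t_0)=y(T)$. A closed solution $y$ is called isolated if there is $\varepsilon>0$ such that every closed solution $z$ of (1.1) on $[t_0,T]$ with $|z(t_0)-y(t_0)|<\varepsilon$ coincides with $y$ on $[t_0,T]$. **Corollary 5.1.** Assume that for some $j\in\{2,\dots,n\}$ and all $t\in[t_0,T]$ $$(-1)^k a_k(t)\ge 0\quad (k=j,\dots,n),\qquad \sum_{k=j}^{n}(-1)^k a_k(t)>0,\qquad a_0(t)\le 0 .$$ Then: ($\alpha$) Equation (1.1) has a closed solution $y_*$ on $[t_0,T]$ with $y_*(t)\le 0$ for all $t\in[t_0,T]$. ($\beta$) If $a_0\not\equiv 0$ on $[t_0,T]$, then every such $y_*$ is negative, i.e. $y_*(t)<0$ for all $t\in[t_0,T]$. ($\gamma$) If $j=2$ and $\int_{t_0}^{T}a_1(t)\,dt>0$, then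 every such $y_*$ is isolated. -/

import Mathlib

/-- `y` is a (classical) solution on `[t₀, T]` of the polynomial equation
`y' + ∑_{k=0}^n a_k(t) y^k = 0`; the derivative is one-sided at the two endpoints. -/
def IsPolySolution (n : ℕ) (a : ℕ → ℝ → ℝ) (t₀ T : ℝ) (y : ℝ → ℝ) : Prop :=
  ∀ t ∈ Set.Icc t₀ T,
    HasDerivWithinAt y (-∑ k ∈ Finset.range (n + 1), a k t * y t ^ k) (Set.Icc t₀ T) t

/-- A solution `y` on `[t₀, T]` is closed if `y(t₀) = y(T)`. -/
def IsClosedPolySolution (n : ℕ) (a : ℕ → ℝ → ℝ) (t₀ T : ℝ) (y : ℝ → ℝ) : Prop :=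
  IsPolySolution n a t₀ T y ∧ y t₀ = y T

/-- A closed solution `y` on `[t₀, T]` is isolated if no other closed solution has an initial value
close to `y(t₀)`. Functions are compared on `[t₀, T]` only. -/
def IsIsolatedClosedPolySolution (n : ℕ) (a : ℕ → ℝ → ℝ) (t₀ T : ℝ) (y : ℝ → ℝ) : Prop :=
  IsClosedPolySolution n a t₀ T y ∧
    ∃ ε > 0, ∀ z : ℝ → ℝ, IsClosedPolySolution n a t₀ T z → |z t₀ - y t₀| < ε →
      Set.EqOn z y (Set.Icc t₀ T)

/-! Write P(t,y) for the polynomial sum. For large R, P(t,-R) ≥ 0 ≥ P(t,0) = a₀(t), so y' = -P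
points outwards at both ends of [-R,0]. The backward flow therefore maps [-R,0] into itself, and a
fixed point gives a closed solution. The rest uses the divided difference Q of P: the difference w
of two solutions satisfies w' = -Q w. Comparing y ≤ 0 with 0 makes y times an integrating factor
nondecreasing, so a single zero of a closed y spreads to all of [t₀,T], and then a₀ ≡ 0. For
isolation it suffices that ∫ ∂P/∂y along y is nonzero: a second closed solution would force ∫ Q = 0,
which fails near y. If y ≡ 0 this integral is ∫ a₁ > 0. If y < 0, then ∫ P/y = -∫ y'/y = 0 while P/y
> ∂P/∂y, so it is negative. -/

open Set intervalIntegral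

/-! ### Integrating factors and scalar comparison -/

/-- The primitive of a function continuous on `[b, c]` is differentiable there. -/
theorem hasDerivWithinAt_integral_Icc {b c : ℝ} {g : ℝ → ℝ} (hbc : b ≤ c)
    (hg : ContinuousOn g (Icc b c)) {t : ℝ} (ht : t ∈ Icc b c) :
    HasDerivWithinAt (fun s => ∫ x in b..s, g x) (g t) (Icc b c) t := by
  have h := ODE.hasDerivWithinAt_picard_Icc (f := fun s _ => g s) (α := fun _ => (0 : ℝ))
    (u := univ) (left_mem_Icc.2 hbc) (hg.comp continuousOn_fst fun p hp => hp.1)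
    continuousOn_const (fun _ _ => mem_univ _) 0 ht
  refine h.congr_of_mem (fun s _ => ?_) ht
  simp [ODE.picard]

/-- Multiplying a function by an integrating factor. -/
theorem HasDerivWithinAt.mul_exp_integral {b c : ℝ} {g w : ℝ → ℝ} {w' : ℝ} (hbc : b ≤ c)
    (hg : ContinuousOn g (Icc b c)) {t : ℝ} (ht : t ∈ Icc b c)
    (hw : HasDerivWithinAt w w' (Icc b c) t) :
    HasDerivWithinAt (fun s => w s * Real.exp (∫ x in b..s, g x))
      ((w' + w t * g t) * Real.exp (∫ x in b..t, g x)) (Icc b c) t := by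
  exact (hw.mul (hasDerivWithinAt_integral_Icc hbc hg ht).exp).congr_deriv (by ring)

/-- A function with nonnegative one-sided derivatives on a compact interval is monotone. -/
theorem monotoneOn_Icc_of_hasDerivWithinAt_nonneg {b c : ℝ} {f f' : ℝ → ℝ}
    (hf : ∀ t ∈ Icc b c, HasDerivWithinAt f (f' t) (Icc b c) t)
    (hf' : ∀ t ∈ Icc b c, 0 ≤ f' t) : MonotoneOn f (Icc b c) := by
  refine monotoneOn_of_hasDerivWithinAt_nonneg (f' := f') (convex_Icc b c)
    (fun t ht => (hf t ht).continuousWithinAt)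
    (fun t ht => (hf t (interior_subset ht)).mono interior_subset)
    (fun t ht => hf' t (interior_subset ht))

/-- Solution formula for the homogeneous linear equation `w' = -g w`. -/
theorem mul_exp_integral_eq_of_linear {b c : ℝ} {g w : ℝ → ℝ} (hbc : b ≤ c)
    (hg : ContinuousOn g (Icc b c))
    (hw : ∀ t ∈ Icc b c, HasDerivWithinAt w (-(g t * w t)) (Icc b c) t) {t : ℝ}
    (ht : t ∈ Icc b c) : w t * Real.exp (∫ x in b..t, g x) = w b := by
  have key : ∀ s ∈ Icc b c, HasDerivWithinAt (fun s => w s * Real.exp (∫ x in b..s, g x))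
      0 (Icc b c) s := fun s hs => by
    exact ((hw s hs).mul_exp_integral hbc hg hs).congr_deriv (by ring)
  have h1 := monotoneOn_Icc_of_hasDerivWithinAt_nonneg key (fun _ _ => le_rfl)
    (left_mem_Icc.2 hbc) ht ht.1
  have h2 := monotoneOn_Icc_of_hasDerivWithinAt_nonneg (fun s hs => (key s hs).neg)
    (fun _ _ => by simp) (left_mem_Icc.2 hbc) ht ht.1
  simp only [Pi.neg_apply, integral_same, Real.exp_zero, mul_one] at h1 h2
  linarith

/-- If `y` increases whenever it exceeds `m` and ends at most at `m`, it never exceeds `m`. -/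
theorem le_of_deriv_nonneg_above {b c m : ℝ} {y y' : ℝ → ℝ}
    (hy : ∀ t ∈ Icc b c, HasDerivWithinAt y (y' t) (Icc b c) t)
    (hy' : ∀ t ∈ Icc b c, m < y t → 0 ≤ y' t) (hc : y c ≤ m) {t : ℝ} (ht : t ∈ Icc b c) :
    y t ≤ m := by
  by_contra! hlt
  have hcont : ContinuousOn y (Icc t c) := fun s hs =>
    ((hy s ⟨ht.1.trans hs.1, hs.2⟩).continuousWithinAt).mono (Icc_subset_Icc_left ht.1)
  have hclosed : IsClosed (Icc t c ∩ y ⁻¹' Iic m) := hcont.preimage_isClosed_of_isClosed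
    isClosed_Icc isClosed_Iic
  have hcomp : IsCompact (Icc t c ∩ y ⁻¹' Iic m) :=
    isCompact_Icc.of_isClosed_subset hclosed inter_subset_left
  -- Here s is the first time from t on with y ≤ m; before s, y exceeds m and so cannot decrease.
  obtain ⟨s, ⟨hs, hsm⟩, hmin⟩ := hcomp.exists_isLeast ⟨c, right_mem_Icc.2 ht.2, hc⟩
  have hsub : Icc t s ⊆ Icc b c := Icc_subset_Icc ht.1 hs.2
  have hmono : MonotoneOn y (Icc t s) := by
    refine monotoneOn_of_hasDerivWithinAt_nonneg (f' := y') (convex_Icc t s)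
      (fun x hx => ((hy x (hsub hx)).continuousWithinAt).mono hsub)
      (fun x hx => (hy x (hsub (interior_subset hx))).mono (interior_subset.trans hsub))
      (fun x hx => hy' x (hsub (interior_subset hx)) ?_)
    rw [interior_Icc] at hx
    by_contra! hle
    exact absurd (hmin ⟨⟨hx.1.le, hx.2.le.trans hs.2⟩, hle⟩) (not_le.2 hx.2)
  have := hmono (left_mem_Icc.2 hs.1) (right_mem_Icc.2 hs.1) hs.1
  have hsm' : y s ≤ m := hsm
  linarith

/-! ### Fixed point of the backward flow -/

/-- A bounded Lipschitz scalar equation whose field points outwards at both ends of `[p, q]` has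
a solution with equal end values that stays in `[p, q]`. -/
theorem exists_closed_solution_of_outward {b c p q : ℝ} (hbc : b ≤ c) (hpq : p ≤ q)
    {F : ℝ → ℝ → ℝ} {K L : NNReal} (hLip : ∀ t ∈ Icc b c, LipschitzWith K (F t))
    (hcont : ∀ x, ContinuousOn (fun t => F t x) (Icc b c))
    (hbound : ∀ t ∈ Icc b c, ∀ x, |F t x| ≤ L)
    (hq : ∀ t ∈ Icc b c, ∀ x, q < x → 0 ≤ F t x)
    (hp : ∀ t ∈ Icc b c, ∀ x, x < p → F t x ≤ 0) :
    ∃ y : ℝ → ℝ, (∀ t ∈ Icc b c, HasDerivWithinAt y (F t (y t)) (Icc b c) t) ∧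
      y b = y c ∧ ∀ t ∈ Icc b c, y t ∈ Icc p q := by
  let r : NNReal := ⟨(q - p) / 2, by linarith⟩
  let d : NNReal := ⟨c - b, by linarith⟩
  have hr : (r : ℝ) = (q - p) / 2 := rfl
  have hd : (d : ℝ) = c - b := rfl
  -- The data are prescribed at the right endpoint c, since an outward field keeps [p,q] invariant
  -- only backwards in time.
  have hPL : IsPicardLindelof F (⟨c, right_mem_Icc.2 hbc⟩ : Icc b c) ((p + q) / 2)
      (r + L * d) r L K :=
    { lipschitzOnWith := fun t ht => (hLip t ht).lipschitzOnWith
      continuousOn := fun x _ => hcont x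
      norm_le := fun t ht x _ => hbound t ht x
      mul_max_le := by
        have : max (c - c) (c - b) = c - b := max_eq_right (by linarith)
        simp only [this]
        push_cast
        simp [hd] }
  obtain ⟨α, hα, L', hL'⟩ :=
    hPL.exists_forall_mem_closedBall_eq_hasDerivWithinAt_lipschitzOnWith
  have hball : Metric.closedBall ((p + q) / 2) (r : ℝ) = Icc p q := by
    rw [Real.closedBall_eq_Icc]
    congr 1 <;> rw [hr] <;> ring
  rw [hball] at hα hL'
  have hinv : ∀ x ∈ Icc p q, ∀ t ∈ Icc b c, α x t ∈ Icc p q := by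
    intro x hx t ht
    obtain ⟨h0, hd⟩ := hα x hx
    simp only at h0
    constructor
    · have := le_of_deriv_nonneg_above (m := -p) (fun s hs => (hd s hs).neg)
        (fun s hs h => by
          have := hp s hs (α x s) (by simp only [Pi.neg_apply] at h; linarith)
          linarith) (by simp only [Pi.neg_apply, h0]; linarith [hx.1]) ht
      simp only [Pi.neg_apply] at this
      linarith
    · exact le_of_deriv_nonneg_above hd (fun s hs h => hq s hs _ h) (h0.trans_le hx.2) ht
  have hb : b ∈ Icc b c := left_mem_Icc.2 hbc
  obtain ⟨x, hx, hfix⟩ := exists_mem_Icc_isFixedPt_of_mapsTo (hL' b hb).continuousOn hpq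
    (fun x hx => hinv x hx b hb)
  exact ⟨α x, (hα x hx).2, hfix.trans (hα x hx).1.symm, hinv x hx⟩

/-! ### Divided differences -/

/-- The divided difference in `x` of the polynomial `∑_{k=0}^n a_k(t) x^k`. -/
def polyDividedDiff (n : ℕ) (a : ℕ → ℝ → ℝ) (t p q : ℝ) : ℝ :=
  ∑ k ∈ Finset.range (n + 1), a k t * ∑ i ∈ Finset.range k, p ^ i * q ^ (k - 1 - i)

theorem polyDividedDiff_mul_sub (n : ℕ) (a : ℕ → ℝ → ℝ) (t p q : ℝ) :
    polyDividedDiff n a t p q * (p - q) =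
      ∑ k ∈ Finset.range (n + 1), a k t * p ^ k - ∑ k ∈ Finset.range (n + 1), a k t * q ^ k := by
  rw [polyDividedDiff, Finset.sum_mul, ← Finset.sum_sub_distrib]
  exact Finset.sum_congr rfl fun k _ => by rw [mul_assoc, geom_sum₂_mul, mul_sub]

/-- On the diagonal the divided difference is ∂P/∂y, the coefficient of the variational equation. -/
theorem polyDividedDiff_self (n : ℕ) (a : ℕ → ℝ → ℝ) (t p : ℝ) :
    polyDividedDiff n a t p p = ∑ k ∈ Finset.range (n + 1), a k t * (k * p ^ (k - 1)) := by
  simp only [polyDividedDiff, geom_sum₂_self]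

theorem continuousOn_polyDividedDiff {X : Type*} [TopologicalSpace X] {n : ℕ} {a : ℕ → ℝ → ℝ}
    {t₀ T : ℝ} (ha : ∀ k ≤ n, ContinuousOn (a k) (Icc t₀ T)) {S : Set X} {τ P Q : X → ℝ}
    (hτ : ContinuousOn τ S) (hmaps : MapsTo τ S (Icc t₀ T)) (hP : ContinuousOn P S)
    (hQ : ContinuousOn Q S) :
    ContinuousOn (fun x => polyDividedDiff n a (τ x) (P x) (Q x)) S := by
  unfold polyDividedDiff
  refine continuousOn_finsetSum _ fun k hk => ?_
  refine ((ha k (Nat.lt_succ_iff.1 (Finset.mem_range.1 hk))).comp hτ hmaps).mul ?_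
  exact continuousOn_finsetSum _ fun i _ => (hP.pow _).mul (hQ.pow _)

theorem continuousOn_polySum {n : ℕ} {a : ℕ → ℝ → ℝ}
    {t₀ T : ℝ} (ha : ∀ k ≤ n, ContinuousOn (a k) (Icc t₀ T)) {X : Type*} [TopologicalSpace X]
    {S : Set X} {τ P : X → ℝ}
    (hτ : ContinuousOn τ S) (hmaps : MapsTo τ S (Icc t₀ T)) (hP : ContinuousOn P S) :
    ContinuousOn (fun x => ∑ k ∈ Finset.range (n + 1), a k (τ x) * P x ^ k) S :=
  continuousOn_finsetSum _ fun k hk =>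
    ((ha k (Nat.lt_succ_iff.1 (Finset.mem_range.1 hk))).comp hτ hmaps).mul (hP.pow _)

theorem IsPolySolution.continuousOn {n : ℕ} {a : ℕ → ℝ → ℝ} {t₀ T : ℝ} {y : ℝ → ℝ}
    (hy : IsPolySolution n a t₀ T y) : ContinuousOn y (Icc t₀ T) :=
  fun t ht => (hy t ht).continuousWithinAt

/-! ### Existence of a nonpositive closed solution -/

/-- The polynomial field has a fixed sign far to the left. -/
theorem exists_polySum_neg_nonneg {n j : ℕ} (hj : 1 ≤ j) (hjn : j ≤ n) {t₀ T : ℝ} (hT : t₀ ≤ T)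
    {a : ℕ → ℝ → ℝ} (ha : ∀ k ≤ n, ContinuousOn (a k) (Icc t₀ T))
    (hsign : ∀ k ∈ Finset.Icc j n, ∀ t ∈ Icc t₀ T, 0 ≤ (-1 : ℝ) ^ k * a k t)
    (hsum : ∀ t ∈ Icc t₀ T, 0 < ∑ k ∈ Finset.Icc j n, (-1 : ℝ) ^ k * a k t) :
    ∃ R : ℝ, 0 ≤ R ∧ ∀ t ∈ Icc t₀ T, 0 ≤ ∑ k ∈ Finset.range (n + 1), a k t * (-R) ^ k := by
  have hne : (Icc t₀ T).Nonempty := nonempty_Icc.2 hT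
  have hc1 : ContinuousOn (fun t => ∑ k ∈ Finset.Icc j n, (-1 : ℝ) ^ k * a k t) (Icc t₀ T) :=
    continuousOn_finsetSum _ fun k hk => continuousOn_const.mul (ha k (Finset.mem_Icc.1 hk).2)
  have hc2 : ContinuousOn (fun t => ∑ k ∈ Finset.range j, |a k t|) (Icc t₀ T) :=
    continuousOn_finsetSum _ fun k hk => (ha k ((Finset.mem_range.1 hk).le.trans hjn)).abs
  obtain ⟨s, hs, hmin⟩ := isCompact_Icc.exists_isMinOn hne hc1
  obtain ⟨u, hu, hmax⟩ := isCompact_Icc.exists_isMaxOn hne hc2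
  set m := ∑ k ∈ Finset.Icc j n, (-1 : ℝ) ^ k * a k s with hm
  set C := ∑ k ∈ Finset.range j, |a k u| with hC
  have hm0 : 0 < m := hsum s hs
  -- With R ≥ 1 the terms below j are at least -C R^(j-1) and the others at least m R^j; R ≥ C/m
  -- lets the latter win.
  set R := max 1 (C / m) with hR
  have hR1 : 1 ≤ R := le_max_left _ _
  have hRC : C ≤ m * R := by
    rw [mul_comm]; exact (div_le_iff₀ hm0).1 (le_max_right _ _)
  refine ⟨R, by linarith, fun t ht => ?_⟩
  have hm' : m ≤ ∑ k ∈ Finset.Icc j n, (-1 : ℝ) ^ k * a k t := hmin ht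
  have hC' : ∑ k ∈ Finset.range j, |a k t| ≤ C := hmax ht
  have hlow : -(C * R ^ (j - 1)) ≤ ∑ k ∈ Finset.range j, a k t * (-R) ^ k := by
    have h1 : |∑ k ∈ Finset.range j, a k t * (-R) ^ k| ≤
        ∑ k ∈ Finset.range j, |a k t| * R ^ (j - 1) := by
      refine (Finset.abs_sum_le_sum_abs _ _).trans (Finset.sum_le_sum fun k hk => ?_)
      rw [abs_mul, abs_pow, abs_neg, abs_of_nonneg (by linarith : 0 ≤ R)]
      have := Finset.mem_range.1 hk
      gcongr
      omega
    rw [← Finset.sum_mul] at h1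
    have h2 := mul_le_mul_of_nonneg_right hC' (by positivity : 0 ≤ R ^ (j - 1))
    linarith [neg_abs_le (∑ k ∈ Finset.range j, a k t * (-R) ^ k)]
  have hhigh : m * R ^ j ≤ ∑ k ∈ Finset.Icc j n, a k t * (-R) ^ k := by
    calc m * R ^ j ≤ (∑ k ∈ Finset.Icc j n, (-1 : ℝ) ^ k * a k t) * R ^ j := by gcongr
      _ = ∑ k ∈ Finset.Icc j n, (-1 : ℝ) ^ k * a k t * R ^ j := Finset.sum_mul _ _ _
      _ ≤ ∑ k ∈ Finset.Icc j n, a k t * (-R) ^ k := by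
        refine Finset.sum_le_sum fun k hk => ?_
        rw [neg_pow R, mul_left_comm, ← mul_assoc]
        exact mul_le_mul_of_nonneg_left (pow_le_pow_right₀ hR1 (Finset.mem_Icc.1 hk).1)
          (hsign k hk t ht)
  have hsplit : ∑ k ∈ Finset.range (n + 1), a k t * (-R) ^ k =
      ∑ k ∈ Finset.range j, a k t * (-R) ^ k + ∑ k ∈ Finset.Icc j n, a k t * (-R) ^ k := by
    rw [← Finset.sum_range_add_sum_Ico _ (by omega : j ≤ n + 1)]
    rfl
  rw [hsplit]
  have hpow : R ^ j = R * R ^ (j - 1) := by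
    rw [← pow_succ', Nat.sub_add_cancel hj]
  have := mul_le_mul_of_nonneg_right hRC (by positivity : 0 ≤ R ^ (j - 1))
  rw [hpow, ← mul_assoc] at hhigh
  linarith

/-- Existence of a closed solution between `-R` and `0`. -/
theorem exists_isClosedPolySolution_mem_Icc {n : ℕ} {t₀ T : ℝ} (hT : t₀ ≤ T)
    {a : ℕ → ℝ → ℝ} (ha : ∀ k ≤ n, ContinuousOn (a k) (Icc t₀ T))
    (ha₀ : ∀ t ∈ Icc t₀ T, a 0 t ≤ 0) {R : ℝ} (hR : 0 ≤ R)
    (hneg : ∀ t ∈ Icc t₀ T, 0 ≤ ∑ k ∈ Finset.range (n + 1), a k t * (-R) ^ k) :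
    ∃ y : ℝ → ℝ, IsClosedPolySolution n a t₀ T y ∧ ∀ t ∈ Icc t₀ T, y t ∈ Icc (-R) 0 := by
  -- Clamping to [-R,0] makes the field globally bounded and Lipschitz; the solution found stays
  -- where κ is the identity.
  let κ : ℝ → ℝ := fun x => max (-R) (min x 0)
  have hκmem : ∀ x, κ x ∈ Icc (-R) 0 := fun x =>
    ⟨le_max_left _ _, max_le (by linarith) (min_le_right _ _)⟩
  have hκid : ∀ x ∈ Icc (-R) 0, κ x = x := fun x hx => by
    simp only [κ, min_eq_left hx.2, max_eq_right hx.1]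
  have hκLip : LipschitzWith 1 κ := (LipschitzWith.id.min_const 0).const_max (-R)
  let D : Set (ℝ × ℝ × ℝ) := Icc t₀ T ×ˢ (Icc (-R) 0 ×ˢ Icc (-R) 0)
  have hD : IsCompact D := isCompact_Icc.prod (isCompact_Icc.prod isCompact_Icc)
  obtain ⟨K, hK⟩ := hD.exists_bound_of_continuousOn
    (continuousOn_polyDividedDiff ha (τ := fun x : ℝ × ℝ × ℝ => x.1) (P := fun x => x.2.1)
      (Q := fun x => x.2.2) (by fun_prop) (fun x hx => hx.1) (by fun_prop) (by fun_prop))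
  obtain ⟨L, hL⟩ := (isCompact_Icc.prod isCompact_Icc :
      IsCompact (Icc t₀ T ×ˢ Icc (-R) 0)).exists_bound_of_continuousOn
    (continuousOn_polySum ha (τ := fun x : ℝ × ℝ => x.1) (P := fun x => x.2)
      (by fun_prop) (fun x hx => hx.1) (by fun_prop))
  obtain ⟨y, hy, hclosed, hmem⟩ := exists_closed_solution_of_outward hT
    (by linarith : -R ≤ 0) (F := fun t x => -∑ k ∈ Finset.range (n + 1), a k t * κ x ^ k)
    (K := K.toNNReal) (L := L.toNNReal) (fun t ht => LipschitzWith.of_dist_le_mul fun p q => by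
      rw [dist_neg_neg, Real.dist_eq, ← polyDividedDiff_mul_sub, abs_mul]
      have h1 : |polyDividedDiff n a t (κ p) (κ q)| ≤ K.toNNReal :=
        (hK (t, κ p, κ q) ⟨ht, hκmem p, hκmem q⟩).trans (Real.le_coe_toNNReal K)
      have h2 : |κ p - κ q| ≤ dist p q := by
        simpa [Real.dist_eq] using hκLip.dist_le_mul p q
      exact mul_le_mul h1 h2 (abs_nonneg _) (NNReal.coe_nonneg _))
    (fun x => (continuousOn_polySum ha continuousOn_id (mapsTo_id _) continuousOn_const).neg)
    (fun t ht x => by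
      rw [abs_neg]
      exact (hL (t, κ x) ⟨ht, hκmem x⟩).trans (Real.le_coe_toNNReal L))
    (fun t ht x hx => by
      have h0 : κ x = 0 := by simp only [κ, min_eq_right hx.le]; exact max_eq_right (by linarith)
      have : ∑ k ∈ Finset.range (n + 1), a k t * κ x ^ k = a 0 t := by
        rw [Finset.sum_range_succ', h0]; simp
      rw [this]
      linarith [ha₀ t ht])
    (fun t ht x hx => by
      have h0 : κ x = -R := max_eq_left ((min_le_left _ _).trans hx.le)
      rw [h0]
      linarith [hneg t ht])
  refine ⟨y, ⟨fun t ht => ?_, hclosed⟩, hmem⟩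
  have := hy t ht
  rwa [hκid _ (hmem t ht)] at this

/-! ### Zeros of nonpositive closed solutions -/

/-- A nonpositive closed solution which vanishes somewhere is identically zero. -/
theorem IsClosedPolySolution.eq_zero_of_nonpos {n : ℕ} {t₀ T : ℝ} (hT : t₀ ≤ T)
    {a : ℕ → ℝ → ℝ} (ha : ∀ k ≤ n, ContinuousOn (a k) (Icc t₀ T))
    (ha₀ : ∀ t ∈ Icc t₀ T, a 0 t ≤ 0) {y : ℝ → ℝ} (hy : IsClosedPolySolution n a t₀ T y)
    (hnonpos : ∀ t ∈ Icc t₀ T, y t ≤ 0) {s : ℝ} (hs : s ∈ Icc t₀ T) (hys : y s = 0) :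
    ∀ t ∈ Icc t₀ T, y t = 0 := by
  have hg := continuousOn_polyDividedDiff ha continuousOn_id (mapsTo_id _) hy.1.continuousOn
    (continuousOn_const (c := (0 : ℝ)))
  simp only [id] at hg
  have hmono := monotoneOn_Icc_of_hasDerivWithinAt_nonneg
    (fun t ht => (hy.1 t ht).mul_exp_integral hT hg ht) (fun t ht => by
      have h1 := polyDividedDiff_mul_sub n a t (y t) 0
      have h2 : ∑ k ∈ Finset.range (n + 1), a k t * (0 : ℝ) ^ k = a 0 t := by
        rw [Finset.sum_range_succ']; simp
      rw [h2, sub_zero] at h1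
      refine mul_nonneg ?_ (Real.exp_pos _).le
      linarith [ha₀ t ht])
  have hforward : ∀ r ∈ Icc t₀ T, y r = 0 → ∀ t ∈ Icc t₀ T, r ≤ t → y t = 0 := by
    intro r hr hyr t ht hrt
    have h := hmono hr ht hrt
    simp only [hyr, zero_mul] at h
    exact le_antisymm (hnonpos t ht) (nonneg_of_mul_nonneg_left h (Real.exp_pos _))
  -- Zeros spread only forwards; closedness carries the one at T back to t₀.
  have hyT : y T = 0 := hforward s hs hys T (right_mem_Icc.2 hT) hs.2
  exact fun t ht => hforward t₀ (left_mem_Icc.2 hT) (hy.2.trans hyT) t ht ht.1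

/-! ### Isolation and the variational integral -/

/-- A closed solution with nonvanishing variational integral is isolated. -/
theorem IsClosedPolySolution.isIsolated_of_integral_ne_zero {n : ℕ} {t₀ T : ℝ} (hT : t₀ < T)
    {a : ℕ → ℝ → ℝ} (ha : ∀ k ≤ n, ContinuousOn (a k) (Icc t₀ T))
    {y : ℝ → ℝ} (hy : IsClosedPolySolution n a t₀ T y)
    (hne : ∫ t in t₀..T, polyDividedDiff n a t (y t) (y t) ≠ 0) :
    IsIsolatedClosedPolySolution n a t₀ T y := by
  refine ⟨hy, ?_⟩
  set I := ∫ t in t₀..T, polyDividedDiff n a t (y t) (y t) with hI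
  have hyc := hy.1.continuousOn
  let D : Set (ℝ × ℝ) := Icc t₀ T ×ˢ Icc (-1) 1
  have hD : IsCompact D := isCompact_Icc.prod isCompact_Icc
  have hy1 : ContinuousOn (fun x : ℝ × ℝ => y x.1) D :=
    hyc.comp continuousOn_fst fun x hx => hx.1
  have hH : ContinuousOn (fun x : ℝ × ℝ => polyDividedDiff n a x.1 (y x.1 + x.2) (y x.1)) D :=
    continuousOn_polyDividedDiff ha continuousOn_fst (fun x hx => hx.1)
      (hy1.add continuousOn_snd) hy1
  obtain ⟨K, hK⟩ := hD.exists_bound_of_continuousOn hH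
  have hK0 : 0 ≤ K := (norm_nonneg _).trans
    (hK (t₀, 0) ⟨left_mem_Icc.2 hT.le, by constructor <;> norm_num⟩)
  -- Changing the integrand by at most this much moves the integral by at most |I|/2.
  have hη : 0 < |I| / (2 * (T - t₀)) := div_pos (abs_pos.2 hne) (by linarith)
  obtain ⟨δ, hδ, huc⟩ := Metric.uniformContinuousOn_iff.1
    (hD.uniformContinuousOn_of_continuous hH) _ hη
  set ρ := min 1 (δ / 2) with hρ
  have hρ0 : 0 < ρ := lt_min one_pos (half_pos hδ)
  have hρ1 : ρ ≤ 1 := min_le_left _ _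
  have hρδ : ρ < δ := (min_le_right _ _).trans_lt (half_lt_self hδ)
  -- Growth rate K + 1 instead of K gives the strict inequality needed at a contact with the
  -- barrier.
  set E := Real.exp ((K + 1) * (T - t₀)) with hE
  have hE0 : 0 < E := Real.exp_pos _
  refine ⟨ρ / E, div_pos hρ0 hE0, fun z hz hclose => ?_⟩
  let w : ℝ → ℝ := fun t => z t - y t
  have hw : ∀ t ∈ Icc t₀ T, HasDerivWithinAt w
      (-(polyDividedDiff n a t (z t) (y t) * w t)) (Icc t₀ T) t := fun t ht =>
    ((hz.1 t ht).sub (hy.1 t ht)).congr_deriv (by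
      rw [polyDividedDiff_mul_sub]; ring)
  have hsmall : ∀ t ∈ Icc t₀ T, |w t| ≤ ρ := by
    have hB : ∀ t, HasDerivAt (fun s => ρ / E * Real.exp ((K + 1) * (s - t₀)))
        ((K + 1) * (ρ / E * Real.exp ((K + 1) * (t - t₀)))) t := fun t => by
      have h1 : HasDerivAt (fun s => (K + 1) * (s - t₀)) (K + 1) t := by
        simpa using ((hasDerivAt_id t).sub_const t₀).const_mul (K + 1)
      exact (h1.exp.const_mul (ρ / E)).congr_deriv (by ring)
    have hBle : ∀ t ∈ Icc t₀ T, ρ / E * Real.exp ((K + 1) * (t - t₀)) ≤ ρ := fun t ht => by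
      have : Real.exp ((K + 1) * (t - t₀)) ≤ E := Real.exp_le_exp.2
        (mul_le_mul_of_nonneg_left (by linarith [ht.2]) (by linarith))
      rw [div_mul_eq_mul_div, div_le_iff₀ hE0]
      exact mul_le_mul_of_nonneg_left this hρ0.le
    intro t ht
    refine le_trans ?_ (hBle t ht)
    refine image_norm_le_of_norm_deriv_right_lt_deriv_boundary (f := w)
      (fun s hs => (hw s hs).continuousWithinAt)
      (fun s hs => (hw s (Ico_subset_Icc_self hs)).mono_of_mem_nhdsWithin
        (Icc_mem_nhdsGE_of_mem hs)) ?_ hB ?_ ht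
    · simpa using hclose.le
    · intro s hs heq
      have hs' := Ico_subset_Icc_self hs
      have hpos : 0 < ρ / E * Real.exp ((K + 1) * (s - t₀)) := by positivity
      -- At a contact |w s| equals the barrier, which is at most ρ ≤ 1, so the bound K on D applies.
      have hw1 : |w s| ≤ 1 := by
        rw [← Real.norm_eq_abs, heq]; exact (hBle s hs').trans hρ1
      have hKs := hK (s, w s) ⟨hs', abs_le.1 hw1⟩
      have hzs : y s + w s = z s := by simp [w]
      simp only [hzs] at hKs
      rw [norm_neg, norm_mul, heq]
      nlinarith
  have hG : ContinuousOn (fun t => polyDividedDiff n a t (z t) (y t)) (Icc t₀ T) :=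
    continuousOn_polyDividedDiff ha continuousOn_id (mapsTo_id _) hz.1.continuousOn hyc
  have hG0 : ContinuousOn (fun t => polyDividedDiff n a t (y t) (y t)) (Icc t₀ T) :=
    continuousOn_polyDividedDiff ha continuousOn_id (mapsTo_id _) hyc hyc
  have hsol := fun t ht => mul_exp_integral_eq_of_linear hT.le hG hw (t := t) ht
  have hw0 : w t₀ = 0 := by
    by_contra hw0
    have h1 := hsol T (right_mem_Icc.2 hT.le)
    have h2 : w T = w t₀ := by simp only [w, hz.2, hy.2]
    rw [h2, mul_right_eq_self₀, or_iff_left hw0, Real.exp_eq_one_iff] at h1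
    have h3 : ‖∫ t in t₀..T, (polyDividedDiff n a t (z t) (y t) -
        polyDividedDiff n a t (y t) (y t))‖ ≤ |I| / (2 * (T - t₀)) * |T - t₀| := by
      refine norm_integral_le_of_norm_le_const fun t ht => ?_
      rw [uIoc_of_le hT.le] at ht
      have ht' := Ioc_subset_Icc_self ht
      have := huc (t, w t) ⟨ht', abs_le.1 ((hsmall t ht').trans hρ1)⟩ (t, 0)
        ⟨ht', by constructor <;> norm_num⟩ (by
          simpa [Prod.dist_eq, hδ] using (hsmall t ht').trans_lt hρδ)
      have hzs : y t + w t = z t := by simp [w]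
      simp only [hzs, add_zero] at this
      exact this.le
    rw [integral_sub (hG.intervalIntegrable_of_Icc hT.le) (hG0.intervalIntegrable_of_Icc hT.le),
      h1, ← hI, zero_sub, norm_neg, Real.norm_eq_abs, abs_of_pos (by linarith : 0 < T - t₀)] at h3
    have h4 : |I| / (2 * (T - t₀)) * (T - t₀) = |I| / 2 := by
      have : T - t₀ ≠ 0 := by linarith
      field_simp
    have := abs_pos.2 hne
    linarith
  intro t ht
  have h1 := hsol t ht
  rw [hw0] at h1
  have h2 : w t = 0 := (mul_eq_zero.1 h1).resolve_right (Real.exp_pos _).ne'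
  exact sub_eq_zero.1 h2

/-- The variational integral along a negative closed solution is negative. -/
theorem IsClosedPolySolution.integral_neg_of_neg {n : ℕ} {t₀ T : ℝ} (hT : t₀ < T)
    {a : ℕ → ℝ → ℝ} (ha : ∀ k ≤ n, ContinuousOn (a k) (Icc t₀ T))
    (hsign : ∀ k ∈ Finset.Icc 2 n, ∀ t ∈ Icc t₀ T, 0 ≤ (-1 : ℝ) ^ k * a k t)
    (hsum : ∀ t ∈ Icc t₀ T, 0 < ∑ k ∈ Finset.Icc 2 n, (-1 : ℝ) ^ k * a k t)
    (ha₀ : ∀ t ∈ Icc t₀ T, a 0 t ≤ 0) {y : ℝ → ℝ} (hy : IsClosedPolySolution n a t₀ T y)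
    (hneg : ∀ t ∈ Icc t₀ T, y t < 0) :
    ∫ t in t₀..T, polyDividedDiff n a t (y t) (y t) < 0 := by
  have hyc := hy.1.continuousOn
  let S : ℝ → ℝ := fun t => ∑ k ∈ Finset.range (n + 1), a k t * y t ^ k
  have hS : ContinuousOn (fun t => S t / y t) (Icc t₀ T) :=
    (continuousOn_polySum ha continuousOn_id (mapsTo_id _) hyc).div hyc fun t ht => (hneg t ht).ne
  have hG : ContinuousOn (fun t => polyDividedDiff n a t (y t) (y t)) (Icc t₀ T) :=
    continuousOn_polyDividedDiff ha continuousOn_id (mapsTo_id _) hyc hyc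
  have hlog : ∫ t in t₀..T, S t / y t = 0 := by
    have h1 := mul_exp_integral_eq_of_linear hT.le hS (w := y) (fun t ht =>
      (hy.1 t ht).congr_deriv (by rw [div_mul_cancel₀ _ (hneg t ht).ne])) (right_mem_Icc.2 hT.le)
    rwa [hy.2, mul_right_eq_self₀, or_iff_left (hneg T (right_mem_Icc.2 hT.le)).ne,
      Real.exp_eq_one_iff] at h1
  have hpos : 0 < ∫ t in t₀..T, (S t / y t - polyDividedDiff n a t (y t) (y t)) := by
    refine intervalIntegral_pos_of_pos_on
      ((hS.sub hG).intervalIntegrable_of_Icc hT.le) (fun t ht => ?_) hT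
    have ht' := Ioo_subset_Icc_self ht
    have hyt := hneg t ht'
    have hterm : ∀ k : ℕ, ((k : ℝ) - 1) * ((-1 : ℝ) ^ k * a k t) * (-y t) ^ k =
        ((k : ℝ) - 1) * (a k t * y t ^ k) := fun k => by
      rw [neg_pow (y t)]
      have : ((-1 : ℝ) ^ k) * (-1) ^ k = 1 := by rw [← mul_pow]; simp
      linear_combination ((k : ℝ) - 1) * a k t * y t ^ k * this
    have hsum' : 0 < ∑ k ∈ Finset.Icc 2 n, ((k : ℝ) - 1) * (a k t * y t ^ k) := by
      have hfac : ∀ k ∈ Finset.Icc 2 n, 0 < ((k : ℝ) - 1) * (-y t) ^ k := fun k hk => by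
        have h2 : (2 : ℝ) ≤ k := by exact_mod_cast (Finset.mem_Icc.1 hk).1
        exact mul_pos (by linarith) (pow_pos (by linarith) _)
      obtain ⟨k, hk, hkpos⟩ : ∃ k ∈ Finset.Icc 2 n, 0 < (-1 : ℝ) ^ k * a k t := by
        by_contra! h
        exact absurd (hsum t ht') (not_lt.2 (Finset.sum_nonpos h))
      refine Finset.sum_pos' (fun i hi => ?_) ⟨k, hk, ?_⟩
      · rw [← hterm i, mul_right_comm]
        exact mul_nonneg (hfac i hi).le (hsign i hi t ht')
      · rw [← hterm k, mul_right_comm]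
        exact mul_pos (hfac k hk) hkpos
    have hn : 2 ≤ n := by
      by_contra! h
      simp [Finset.Icc_eq_empty_of_lt h] at hsum'
    -- In yP_y - P = ∑ (k-1) a_k y^k the linear term drops out, so the sign of a₁ plays no role.
    have hid : (S t / y t - polyDividedDiff n a t (y t) (y t)) * (-y t) =
        -a 0 t + ∑ k ∈ Finset.Icc 2 n, ((k : ℝ) - 1) * (a k t * y t ^ k) := by
      have h1 : (S t / y t - polyDividedDiff n a t (y t) (y t)) * (-y t) =
          ∑ k ∈ Finset.range (n + 1), ((k : ℝ) - 1) * (a k t * y t ^ k) := by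
        rw [sub_mul, mul_neg, div_mul_cancel₀ _ hyt.ne, mul_neg, sub_neg_eq_add,
          polyDividedDiff_self, Finset.sum_mul, neg_add_eq_sub, ← Finset.sum_sub_distrib]
        refine Finset.sum_congr rfl fun k _ => ?_
        rcases k with _ | k
        · simp
        · simp only [Nat.add_sub_cancel, pow_succ]; ring
      rw [h1, ← Finset.sum_range_add_sum_Ico _ (by omega : 2 ≤ n + 1)]
      simp only [Finset.sum_range_succ, Finset.sum_range_zero]
      norm_num
      rfl
    have hprod : 0 < (S t / y t - polyDividedDiff n a t (y t) (y t)) * (-y t) := by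
      rw [hid]; linarith [ha₀ t ht']
    exact pos_of_mul_pos_left hprod (by linarith)
  rw [integral_sub (hS.intervalIntegrable_of_Icc hT.le) (hG.intervalIntegrable_of_Icc hT.le),
    hlog] at hpos
  linarith

theorem corollary5p1 (n j : ℕ) (hj : 2 ≤ j) (hjn : j ≤ n) (t₀ T : ℝ) (hT : t₀ < T)
    (a : ℕ → ℝ → ℝ) (ha : ∀ k ≤ n, ContinuousOn (a k) (Set.Icc t₀ T))
    (hsign : ∀ k ∈ Finset.Icc j n, ∀ t ∈ Set.Icc t₀ T, 0 ≤ (-1 : ℝ) ^ k * a k t)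
    (hsum : ∀ t ∈ Set.Icc t₀ T, 0 < ∑ k ∈ Finset.Icc j n, (-1 : ℝ) ^ k * a k t)
    (ha₀ : ∀ t ∈ Set.Icc t₀ T, a 0 t ≤ 0) :
    (∃ y : ℝ → ℝ, IsClosedPolySolution n a t₀ T y ∧ ∀ t ∈ Set.Icc t₀ T, y t ≤ 0) ∧
    ∀ y : ℝ → ℝ, IsClosedPolySolution n a t₀ T y → (∀ t ∈ Set.Icc t₀ T, y t ≤ 0) →
      ((∃ t ∈ Set.Icc t₀ T, a 0 t ≠ 0) → ∀ t ∈ Set.Icc t₀ T, y t < 0) ∧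
      (j = 2 → 0 < ∫ t in t₀..T, a 1 t → IsIsolatedClosedPolySolution n a t₀ T y) := by
  refine ⟨?_, fun y hy hnonpos => ⟨?_, ?_⟩⟩
  · obtain ⟨R, hR, hneg⟩ := exists_polySum_neg_nonneg (by omega) hjn hT.le ha hsign hsum
    obtain ⟨y, hy, hmem⟩ := exists_isClosedPolySolution_mem_Icc hT.le ha ha₀ hR hneg
    exact ⟨y, hy, fun t ht => (hmem t ht).2⟩
  · rintro ⟨s, hs, has⟩ t ht
    refine lt_of_le_of_ne (hnonpos t ht) fun hyt => has ?_
    have hzero := hy.eq_zero_of_nonpos hT.le ha ha₀ hnonpos ht hyt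
    have h1 := hy.1 s hs
    have h2 : HasDerivWithinAt y 0 (Icc t₀ T) s :=
      (hasDerivWithinAt_const s (Icc t₀ T) (0 : ℝ)).congr hzero (hzero s hs)
    have h3 := (uniqueDiffOn_Icc hT s hs).eq_deriv _ h1 h2
    rw [hzero s hs, Finset.sum_range_succ'] at h3
    simpa using h3
  · rintro rfl ha1
    refine hy.isIsolated_of_integral_ne_zero hT ha ?_
    -- Either y < 0 throughout or y ≡ 0; the integral has opposite signs in the two cases.
    by_cases hneg : ∀ t ∈ Icc t₀ T, y t < 0
    · exact (hy.integral_neg_of_neg hT ha hsign hsum ha₀ hneg).ne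
    · push Not at hneg
      obtain ⟨s, hs, hys⟩ := hneg
      have hzero := hy.eq_zero_of_nonpos hT.le ha ha₀ hnonpos hs (le_antisymm (hnonpos s hs) hys)
      have : ∫ t in t₀..T, polyDividedDiff n a t (y t) (y t) = ∫ t in t₀..T, a 1 t := by
        refine integral_congr fun t ht => ?_
        rw [uIcc_of_le hT.le] at ht
        simp only [hzero t ht, polyDividedDiff_self]
        rw [Finset.sum_eq_single_of_mem 1 (Finset.mem_range.2 (by omega))]
        · simp
        · intro k _ hk
          rcases k with _ | _ | k
          · simp
          · exact absurd rfl hk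
          · simp
      rw [this]
      exact ha1.ne'
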